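/- Let $s\ge 1$ and let $\mathcal K$ be the set of double cones of $(s+1)$-dimensional Minkowski space, ordered by inclusion; $\mathcal O'$ denotes the spacelike complement of $\mathcal O$. A $\mathbb Z_2$-graded net $\mathfrak F$ on a complex Hilbert space $\mathcal H_{\mathfrak F}$ is an isotonous family $\mathcal O\mapsto\mathfrak F(\mathcal O)$, $\mathcal O\in\mathcal K$, of von Neumann algebras on $\mathcal H_{\mathfrak F}$ together with a unitary $k=k_{\mathfrak F}$ on $\mathcal H_{\mathfrak F}$ with $k^2=1$ and $k\,\mathfrak F(\mathcal O)\,k=\mathfrak F(\mathcal O)$ for all $\mathcal O$. Put $\mathfrak F_\pm(\mathcal O)=\{A\in\mathfrak F(\mathcal O): kAk=\pm A\}$ and $\mathfrak F^t(\mathcal O)=\mathfrak F_+(\mathcal O)+ik\,\mathfrak F_-(\mathcal O)$. The twisted dual net $\mathfrak F^d$ is the $\mathbb Z_2$-graded net on $\mathcal H_{\mathfrak F}$, with the same $k$, given by $\mathfrak F^d(\mathcal O)=\bigcap_{\mathcal O_1\subset\mathcal O'}\mathfrak F^t(\mathcal O_1)'$. A net morphism is a family of unital $*$-homomorphisms between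 the algebras of two nets, one for each $\mathcal O\in\mathcal K$, compatible with the inclusions $\mathcal O_1\subset\mathcal O_2$. Let $\mathfrak B\subset\mathfrak F$ be an inclusion of $\mathbb Z_2$-graded nets: a net morphism $\mathfrak B\to\mathfrak F$ consisting of injective normal $*$-homomorphisms, together with an inclusion of Hilbert spaces $\mathcal H_{\mathfrak B}\subset\mathcal H_{\mathfrak F}$, such that for each $\mathcal O$ the image in $\mathfrak F(\mathcal O)$ of any $B\in\mathfrak B(\mathcal O)$ agrees with $B$ on $\mathcal H_{\mathfrak B}$, such that $k_{\mathfrak B}$ is the restriction of $k_{\mathfrak F}$, and such that $\mathcal H_{\mathfrak B}$ is cyclic and separating for each $\mathfrak F(\mathcal O)$. Let $E$ be the orthogonal projection of $\mathcal H_{\mathfrak F}$ onto $\mathcal H_{\mathfrak B}$, and let $\mathfrak F^d{}_E(\mathcal O)$ be the set of restrictions to $\mathcal H_{\mathfrak B}$ of the elements of $\mathfrak F^d(\mathcal O)$ that commute with $E$. Then the following are equivalent: a) there is a net morphism $\nu:\mathfrak B^d\to\mathfrak F^d$ such that $\nu(B)\Phi=B\Phi$ for all $\mathcal O\in\mathcal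 K$, $B\in\mathfrak B^d(\mathcal O)$, $\Phi\in\mathcal H_{\mathfrak B}$; b) $\mathfrak B^d(\mathcal O)=\mathfrak F^d{}_E(\mathcal O)$ for all $\mathcal O\in\mathcal K$. A morphism $\nu$ as in a) is necessarily unique, injective, normal and $\mathbb Z_2$-graded, i.e. $\nu(k_{\mathfrak B}Bk_{\mathfrak B})=k_{\mathfrak F}\nu(B)k_{\mathfrak F}$. If the conditions are fulfilled, there is a unique normal conditional expectation $m$ of nets of $\mathfrak F^d$ onto $\nu(\mathfrak B^d)$, that is, a unique family of normal conditional expectations $m_{\mathcal O}$ of $\mathfrak F^d(\mathcal O)$ onto $\nu(\mathfrak B^d(\mathcal O))$, $\mathcal O\in\mathcal K$, compatible with the inclusions $\mathcal O_1\subset\mathcal O_2$, such that $$m(F)E=EFE,\qquad F\in\mathfrak F^d(\mathcal O),\ \mathcal O\in\mathcal K.$$ -/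

import Mathlib

noncomputable section

namespace GradedNets

/-- Minkowski space with one time and `s` space dimensions; a point is `(t, x)`. -/
abbrev Minkowski (s : ℕ) : Type := ℝ × EuclideanSpace ℝ (Fin s)

/-- The open forward light cone. -/
def forwardCone (s : ℕ) : Set (Minkowski s) := {p | ‖p.2‖ < p.1}

/-- The open double cone with past apex `a` and future apex `b`. -/
def doubleConeSet {s : ℕ} (a b : Minkowski s) : Set (Minkowski s) :=
  {p | p - a ∈ forwardCone s ∧ b - p ∈ forwardCone s}

/-- The double cones of Minkowski space, ordered by inclusion. -/
abbrev DoubleCone (s : ℕ) : Type :=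
  {O : Set (Minkowski s) // ∃ a b : Minkowski s, b - a ∈ forwardCone s ∧ O = doubleConeSet a b}

/-- The spacelike complement: all points that are spacelike to every point of `O`. -/
def spacelikeComplement {s : ℕ} (O : Set (Minkowski s)) : Set (Minkowski s) :=
  {p | ∀ q ∈ O, |p.1 - q.1| < ‖p.2 - q.2‖}

/-- A concrete `ℤ₂`-graded net of von Neumann algebras over the double cones: an isotonous
family of von Neumann algebras on `H` with an involutive unitary `k` on `H` that induces an
automorphism of each of the algebras. No commutation relations are assumed. -/
structure GradedNet (s : ℕ) (H : Type*) [NormedAddCommGroup H] [InnerProductSpace ℂ H]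
    [CompleteSpace H] where
  alg : DoubleCone s → VonNeumannAlgebra H
  mono : ∀ ⦃O₁ O₂ : DoubleCone s⦄, O₁ ≤ O₂ → ∀ ⦃A : H →L[ℂ] H⦄, A ∈ alg O₁ → A ∈ alg O₂
  k : H →L[ℂ] H
  k_unitary : k ∈ unitary (H →L[ℂ] H)
  k_mul_k : k * k = 1
  k_conj : ∀ (O : DoubleCone s) (A : H →L[ℂ] H), A ∈ alg O → k * A * k ∈ alg O

namespace GradedNet

variable {s : ℕ} {H : Type*} [NormedAddCommGroup H] [InnerProductSpace ℂ H] [CompleteSpace H]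

/-- The algebra of a double cone, as a star algebra. -/
abbrev Alg (F : GradedNet s H) (O : DoubleCone s) : Type _ := ↥((F.alg O).toStarSubalgebra)

/-- The even (Bose) part. -/
def even (F : GradedNet s H) (O : DoubleCone s) : Set (H →L[ℂ] H) :=
  {A | A ∈ F.alg O ∧ F.k * A * F.k = A}

/-- The odd (Fermi) part. -/
def odd (F : GradedNet s H) (O : DoubleCone s) : Set (H →L[ℂ] H) :=
  {A | A ∈ F.alg O ∧ F.k * A * F.k = -A}

/-- The algebra of the twisted net, even part plus `i k` times odd part. -/
def twisted (F : GradedNet s H) (O : DoubleCone s) : Set (H →L[ℂ] H) :=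
  {T | ∃ A ∈ F.even O, ∃ C ∈ F.odd O, T = A + Complex.I • (F.k * C)}

theorem star_k (F : GradedNet s H) : star F.k = F.k := by
  have h := (Unitary.mem_iff.1 F.k_unitary).1
  calc star F.k = star F.k * (F.k * F.k) := by rw [F.k_mul_k, mul_one]
    _ = F.k := by rw [← mul_assoc, h, one_mul]

theorem odd_anticomm (F : GradedNet s H) {O : DoubleCone s} {C : H →L[ℂ] H} (hC : C ∈ F.odd O) :
    C * F.k = -(F.k * C) := by
  have h : F.k * (F.k * C * F.k) = F.k * (-C) := by rw [hC.2]
  rwa [mul_assoc F.k C, ← mul_assoc F.k F.k, F.k_mul_k, one_mul, mul_neg] at h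

theorem star_mem_twisted (F : GradedNet s H) {O : DoubleCone s} {T : H →L[ℂ] H}
    (hT : T ∈ F.twisted O) : star T ∈ F.twisted O := by
  obtain ⟨A, hA, C, hC, rfl⟩ := hT
  have hC' : star C ∈ F.odd O := by
    refine ⟨star_mem hC.1, ?_⟩
    have := congrArg star hC.2
    simpa [star_mul, F.star_k, mul_assoc] using this
  refine ⟨star A, ⟨star_mem hA.1, ?_⟩, star C, hC', ?_⟩
  · have := congrArg star hA.2
    simpa [star_mul, F.star_k, mul_assoc] using this
  · rw [star_add, star_smul, star_mul, F.star_k, F.odd_anticomm hC']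
    simp

theorem k_conj_mem_twisted (F : GradedNet s H) {O : DoubleCone s} {T : H →L[ℂ] H}
    (hT : T ∈ F.twisted O) : F.k * T * F.k ∈ F.twisted O := by
  obtain ⟨A, hA, C, hC, rfl⟩ := hT
  have hC' : -C ∈ F.odd O := ⟨neg_mem hC.1, by rw [mul_neg, neg_mul, hC.2]⟩
  refine ⟨A, hA, -C, hC', ?_⟩
  rw [mul_add, add_mul, hA.2, mul_smul_comm, smul_mul_assoc, ← hC.2]
  simp only [mul_assoc]

/-- All operators in the twisted algebras of the double cones spacelike to `O`. -/
def twistedSpacelike (F : GradedNet s H) (O : DoubleCone s) : Set (H →L[ℂ] H) :=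
  {T | ∃ O₁ : DoubleCone s, (O₁ : Set (Minkowski s)) ⊆ spacelikeComplement (O : Set _) ∧
    T ∈ F.twisted O₁}

/-- The twisted dual net: the algebra of `O` is the intersection, over the double cones `O₁`
spacelike to `O`, of the commutants of the twisted algebras of `O₁`; the unitary is the same. -/
def dual (F : GradedNet s H) : GradedNet s H where
  alg O :=
    { carrier := Set.centralizer (F.twistedSpacelike O)
      mul_mem' := fun ha hb => Set.mul_mem_centralizer ha hb
      one_mem' := Set.one_mem_centralizer
      add_mem' := fun ha hb => Set.add_mem_centralizer ha hb
      zero_mem' := Set.zero_mem_centralizer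
      algebraMap_mem' := fun r T _ => (Algebra.commutes r T).symm
      star_mem' := fun ha => Set.star_mem_centralizer'
        (fun _ ⟨O₁, h₁, hT⟩ => ⟨O₁, h₁, F.star_mem_twisted hT⟩) ha
      centralizer_centralizer' := Set.centralizer_centralizer_centralizer _ }
  mono := by
    rintro O₁ O₂ h A hA T ⟨O, hO, hT⟩
    exact hA T ⟨O, fun p hp q hq => hO hp q (h hq), hT⟩
  k := F.k
  k_unitary := F.k_unitary
  k_mul_k := F.k_mul_k
  k_conj := by
    rintro O A hA T ⟨O₁, h₁, hT⟩
    have h : (F.k * T * F.k) * A = A * (F.k * T * F.k) := hA _ ⟨O₁, h₁, F.k_conj_mem_twisted hT⟩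
    have h2 := congrArg (fun X => F.k * X * F.k) h
    have e : ∀ X : H →L[ℂ] H, F.k * (F.k * X) = X := fun X => by
      rw [← mul_assoc, F.k_mul_k, one_mul]
    simpa only [mul_assoc, e, F.k_mul_k, mul_one] using h2

theorem mem_dual_alg_iff (F : GradedNet s H) (O : DoubleCone s) (A : H →L[ℂ] H) :
    A ∈ F.dual.alg O ↔ ∀ O₁ : DoubleCone s,
      (O₁ : Set (Minkowski s)) ⊆ spacelikeComplement (O : Set _) →
        ∀ T ∈ F.twisted O₁, T * A = A * T :=
  ⟨fun h O₁ h₁ T hT => h T ⟨O₁, h₁, hT⟩, fun h T ⟨O₁, h₁, hT⟩ => h O₁ h₁ T hT⟩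

end GradedNet

section Maps

variable {s : ℕ} {K H : Type*}
  [NormedAddCommGroup K] [InnerProductSpace ℂ K] [CompleteSpace K]
  [NormedAddCommGroup H] [InnerProductSpace ℂ H] [CompleteSpace H]

/-- A map between von Neumann algebras is normal if it preserves the least upper bounds of
bounded increasing families of self-adjoint elements. -/
def IsNormalMap {M : VonNeumannAlgebra K} {N : VonNeumannAlgebra H}
    (f : ↥M.toStarSubalgebra → ↥N.toStarSubalgebra) : Prop :=
  ∀ D : Set ↥M.toStarSubalgebra, D.Nonempty → (∀ x ∈ D, IsSelfAdjoint x) →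
    DirectedOn (· ≤ ·) D → ∀ a, IsLUB D a → IsLUB (f '' D) (f a)

/-- A net morphism: a family of unital star homomorphisms compatible with isotony. -/
@[ext]
structure NetMorphism (B : GradedNet s K) (F : GradedNet s H) where
  map : ∀ O : DoubleCone s, B.Alg O →⋆ₐ[ℂ] F.Alg O
  compat : ∀ ⦃O₁ O₂ : DoubleCone s⦄ (h : O₁ ≤ O₂) (A : B.Alg O₁),
    (map O₂ ⟨A, B.mono h A.2⟩ : H →L[ℂ] H) = map O₁ A

/-- An inclusion of `ℤ₂`-graded nets: compatible normal inclusions of the algebras, and an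
inclusion `V` of the Hilbert spaces, compatible with the former and with the unitaries, whose
range is cyclic and separating for each algebra of the larger net. -/
structure NetInclusion (B : GradedNet s K) (F : GradedNet s H) where
  ι : NetMorphism B F
  ι_injective : ∀ O, Function.Injective (ι.map O)
  ι_normal : ∀ O, IsNormalMap (ι.map O)
  V : K →ₗᵢ[ℂ] H
  ι_apply_V : ∀ (O : DoubleCone s) (A : B.Alg O) (Φ : K),
    (ι.map O A : H →L[ℂ] H) (V Φ) = V ((A : K →L[ℂ] K) Φ)
  V_k : ∀ Φ : K, V (B.k Φ) = F.k (V Φ)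
  cyclic : ∀ O : DoubleCone s,
    (Submodule.span ℂ {x : H | ∃ A ∈ F.alg O, ∃ Φ : K, x = A (V Φ)}).topologicalClosure = ⊤
  separating : ∀ (O : DoubleCone s), ∀ A ∈ F.alg O, (∀ Φ : K, A (V Φ) = 0) → A = 0

/-- The orthogonal projection `V V*` of the larger Hilbert space onto the range of `V`. -/
def NetInclusion.E {B : GradedNet s K} {F : GradedNet s H} (i : NetInclusion B F) : H →L[ℂ] H :=
  i.V.toContinuousLinearMap ∘L ContinuousLinearMap.adjoint i.V.toContinuousLinearMap

/-- The restriction to the smaller Hilbert space of the operators in `G(O)` that commute with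
the projection `E`, for a net `G` on the larger Hilbert space. -/
def NetInclusion.restrict {B : GradedNet s K} {F : GradedNet s H} (i : NetInclusion B F)
    (G : GradedNet s H) (O : DoubleCone s) : Set (K →L[ℂ] K) :=
  {A | ∃ X ∈ G.alg O, X * i.E = i.E * X ∧ ∀ Φ : K, X (i.V Φ) = i.V (A Φ)}

/-- A conditional expectation of `M` onto a star subalgebra `N` of `M`: a positive linear
contraction of `M` with range `N` that is the identity on `N` and an `N`-bimodule map. -/
structure IsCondExp {M : VonNeumannAlgebra H} (N : StarSubalgebra ℂ ↥M.toStarSubalgebra)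
    (m : ↥M.toStarSubalgebra →ₗ[ℂ] ↥M.toStarSubalgebra) : Prop where
  range_eq : Set.range m = (N : Set ↥M.toStarSubalgebra)
  map_of_mem : ∀ x ∈ N, m x = x
  nonneg : ∀ x, 0 ≤ x → 0 ≤ m x
  norm_le : ∀ x, ‖m x‖ ≤ ‖x‖
  bimodule : ∀ a ∈ N, ∀ b ∈ N, ∀ x, m (a * x * b) = a * m x * b

/-- A conditional expectation of nets, of `F` onto the net of subalgebras `N`. -/
structure IsNetCondExp (F : GradedNet s H) (N : ∀ O, StarSubalgebra ℂ (F.Alg O))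
    (m : ∀ O, F.Alg O →ₗ[ℂ] F.Alg O) : Prop where
  condExp : ∀ O, IsCondExp (N O) (m O)
  compat : ∀ ⦃O₁ O₂ : DoubleCone s⦄ (h : O₁ ≤ O₂) (A : F.Alg O₁),
    (m O₂ ⟨A, F.mono h A.2⟩ : H →L[ℂ] H) = m O₁ A

end Maps

end GradedNets

end

noncomputable section

namespace GradedNets

open Filter Topology
open scoped InnerProductSpace ComplexOrder

section WeakLimits

variable {ι : Type*} {H : Type*} [NormedAddCommGroup H] [InnerProductSpace ℂ H]

/-- Convergence in the weak operator topology. -/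
def WeakTendsto (g : ι → H →L[ℂ] H) (l : Filter ι) (c : H →L[ℂ] H) : Prop :=
  ∀ x y : H, Tendsto (fun j => ⟪g j x, y⟫_ℂ) l (𝓝 ⟪c x, y⟫_ℂ)

theorem WeakTendsto.sub_const {g : ι → H →L[ℂ] H} {l : Filter ι} {c : H →L[ℂ] H}
    (h : WeakTendsto g l c) (A : H →L[ℂ] H) : WeakTendsto (fun j => g j - A) l (c - A) := by
  intro x y
  simpa [inner_sub_left] using (h x y).sub_const ⟪A x, y⟫_ℂ

theorem WeakTendsto.const_sub {g : ι → H →L[ℂ] H} {l : Filter ι} {c : H →L[ℂ] H}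
    (h : WeakTendsto g l c) (A : H →L[ℂ] H) : WeakTendsto (fun j => A - g j) l (A - c) := by
  intro x y
  simpa [inner_sub_left] using (h x y).const_sub ⟪A x, y⟫_ℂ

theorem operator_nonneg_iff (T : H →L[ℂ] H) : 0 ≤ T ↔ ∀ x, 0 ≤ ⟪T x, x⟫_ℂ := by
  rw [ContinuousLinearMap.nonneg_iff_isPositive, ContinuousLinearMap.isPositive_iff_complex]
  refine forall_congr' fun x => ?_
  rw [Complex.nonneg_iff, Complex.ext_iff]
  simp [and_comm]

theorem WeakTendsto.nonneg {g : ι → H →L[ℂ] H} {l : Filter ι} [l.NeBot] {c : H →L[ℂ] H}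
    (h : WeakTendsto g l c) (hg : ∀ᶠ j in l, 0 ≤ g j) : 0 ≤ c := by
  rw [operator_nonneg_iff]
  intro x
  exact ge_of_tendsto (h x x) (hg.mono fun j hj => (operator_nonneg_iff _).1 hj x)

variable [CompleteSpace H]

theorem WeakTendsto.le_of_eventually_le {g : ι → H →L[ℂ] H} {l : Filter ι} [l.NeBot]
    {c A : H →L[ℂ] H} (h : WeakTendsto g l c) (hg : ∀ᶠ j in l, A ≤ g j) : A ≤ c :=
  sub_nonneg.1 ((h.sub_const A).nonneg (hg.mono fun _ hj => sub_nonneg.2 hj))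

theorem WeakTendsto.ge_of_eventually_ge {g : ι → H →L[ℂ] H} {l : Filter ι} [l.NeBot]
    {c A : H →L[ℂ] H} (h : WeakTendsto g l c) (hg : ∀ᶠ j in l, g j ≤ A) : c ≤ A :=
  sub_nonneg.1 ((h.const_sub A).nonneg (hg.mono fun _ hj => sub_nonneg.2 hj))

/-- Bounded families of operators converge weakly along ultrafilters. -/
theorem exists_weakTendsto (U : Ultrafilter ι) (g : ι → H →L[ℂ] H) (C : ℝ)
    (hg : ∀ᶠ j in (U : Filter ι), ‖g j‖ ≤ C) : ∃ c, WeakTendsto g U c := by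
  have hlim : ∀ x y : H, ∃ z ∈ Metric.closedBall (0 : ℂ) (C * ‖x‖ * ‖y‖),
      Tendsto (fun j => ⟪g j x, y⟫_ℂ) U (𝓝 z) := by
    intro x y
    refine (isCompact_closedBall (0 : ℂ) (C * ‖x‖ * ‖y‖)).ultrafilter_le_nhds
      (U.map fun j => ⟪g j x, y⟫_ℂ) ?_
    rw [Ultrafilter.coe_map, le_principal_iff, mem_map]
    filter_upwards [hg] with j hj
    have h1 : ‖⟪g j x, y⟫_ℂ‖ ≤ ‖g j x‖ * ‖y‖ := norm_inner_le_norm _ _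
    have h2 : ‖g j x‖ ≤ C * ‖x‖ := (g j).le_of_opNorm_le hj x
    simpa using h1.trans (mul_le_mul_of_nonneg_right h2 (norm_nonneg y))
  choose b hb hbt using hlim
  let β : H →ₗ⋆[ℂ] H →ₗ[ℂ] ℂ := LinearMap.mk₂'ₛₗ (starRingEnd ℂ) (RingHom.id ℂ) b
    (fun x x' y => tendsto_nhds_unique (hbt (x + x') y) <| by
      simpa [inner_add_left] using (hbt x y).add (hbt x' y))
    (fun r x y => tendsto_nhds_unique (hbt (r • x) y) <| by
      simpa [inner_smul_left, mul_comm] using (hbt x y).const_mul (starRingEnd ℂ r))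
    (fun x y y' => tendsto_nhds_unique (hbt x (y + y')) <| by
      simpa [inner_add_right] using (hbt x y).add (hbt x y'))
    (fun r x y => tendsto_nhds_unique (hbt x (r • y)) <| by
      simpa [inner_smul_right] using (hbt x y).const_mul r)
  refine ⟨InnerProductSpace.continuousLinearMapOfBilin
    (β.mkContinuous₂ C fun x y => by simpa [β] using hb x y), fun x y => ?_⟩
  rw [InnerProductSpace.continuousLinearMapOfBilin_apply]
  exact hbt x y

theorem mem_of_commute (M : VonNeumannAlgebra H) {A : H →L[ℂ] H}
    (hA : ∀ T ∈ Set.centralizer (M : Set (H →L[ℂ] H)), T * A = A * T) : A ∈ M := by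
  have h : A ∈ Set.centralizer (Set.centralizer (M : Set (H →L[ℂ] H))) := hA
  rwa [VonNeumannAlgebra.centralizer_centralizer] at h

theorem WeakTendsto.mem {g : ι → H →L[ℂ] H} {l : Filter ι} [l.NeBot] {c : H →L[ℂ] H}
    (h : WeakTendsto g l c) (M : VonNeumannAlgebra H) (hg : ∀ j, g j ∈ M) : c ∈ M := by
  refine mem_of_commute M fun T hT => ?_
  refine ContinuousLinearMap.ext fun x => ext_inner_right ℂ fun y => ?_
  have h1 := h x (ContinuousLinearMap.adjoint T y)
  refine tendsto_nhds_unique ?_ (h (T x) y)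
  have e : ∀ j, ⟪g j x, ContinuousLinearMap.adjoint T y⟫_ℂ = ⟪g j (T x), y⟫_ℂ := fun j => by
    rw [ContinuousLinearMap.adjoint_inner_right]
    exact congrArg (fun A : H →L[ℂ] H => ⟪A x, y⟫_ℂ) (hT _ (hg j)).symm
  simp only [e] at h1
  rwa [ContinuousLinearMap.adjoint_inner_right] at h1

end WeakLimits

section Normal

variable {K H : Type*}
  [NormedAddCommGroup K] [InnerProductSpace ℂ K] [CompleteSpace K]
  [NormedAddCommGroup H] [InnerProductSpace ℂ H] [CompleteSpace H]

theorem norm_le_of_between {A B C : H →L[ℂ] H} (h₁ : A ≤ B) (h₂ : B ≤ C) :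
    ‖B‖ ≤ ‖C - A‖ + ‖A‖ := by
  have h := CStarAlgebra.norm_le_norm_of_nonneg_of_le (sub_nonneg.2 h₁) (sub_le_sub_right h₂ A)
  calc ‖B‖ = ‖(B - A) + A‖ := by rw [sub_add_cancel]
    _ ≤ ‖B - A‖ + ‖A‖ := norm_add_le _ _
    _ ≤ _ := by gcongr

/-- The least upper bound of a bounded increasing family is its weak limit along a suitable
ultrafilter. -/
theorem exists_ultrafilter_weakTendsto {M : VonNeumannAlgebra K}
    {D : Set ↥M.toStarSubalgebra} (hne : D.Nonempty) (hdir : DirectedOn (· ≤ ·) D)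
    {a : ↥M.toStarSubalgebra} (ha : IsLUB D a) :
    ∃ U : Ultrafilter ↥D, (∀ d₀ : ↥D, ∀ᶠ d in (U : Filter ↥D), d₀ ≤ d) ∧
      WeakTendsto (fun d : ↥D => ((d : ↥M.toStarSubalgebra) : K →L[ℂ] K)) U a := by
  have : Nonempty ↥D := hne.to_subtype
  have : IsDirectedOrder ↥D := ⟨fun x y => by
    obtain ⟨z, hz, hxz, hyz⟩ := hdir x x.2 y y.2
    exact ⟨⟨z, hz⟩, hxz, hyz⟩⟩
  let U : Ultrafilter ↥D := Ultrafilter.of atTop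
  have hU : ∀ d₀ : ↥D, ∀ᶠ d in (U : Filter ↥D), d₀ ≤ d := fun d₀ =>
    (Ultrafilter.of_le atTop) (eventually_ge_atTop d₀)
  obtain ⟨d₀⟩ := ‹Nonempty ↥D›
  obtain ⟨c, hc⟩ := exists_weakTendsto U
    (fun d : ↥D => ((d : ↥M.toStarSubalgebra) : K →L[ℂ] K)) _
    ((hU d₀).mono fun d hd => norm_le_of_between hd (ha.1 d.2))
  have hcM : c ∈ M := hc.mem M fun d => d.1.2
  have hlub : IsLUB D (⟨c, hcM⟩ : ↥M.toStarSubalgebra) := by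
    refine ⟨fun d hd => ?_, fun u hu => ?_⟩
    · exact hc.le_of_eventually_le ((hU ⟨d, hd⟩).mono fun _ h => h)
    · exact hc.ge_of_eventually_ge (Eventually.of_forall fun d => hu d.2)
  refine ⟨U, hU, ?_⟩
  rwa [ha.unique hlub]

/-- A monotone map of von Neumann algebras that is weakly continuous on a separating set of
vectors is normal. -/
theorem isNormalMap_of_intertwines {L : Type*} {M : VonNeumannAlgebra K} {N : VonNeumannAlgebra H}
    (f : ↥M.toStarSubalgebra → ↥N.toStarSubalgebra) (hf : Monotone f)
    (W : L → H) (S : K →L[ℂ] H) (T : L → K)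
    (hW : ∀ A ∈ N, (∀ Φ, A (W Φ) = 0) → A = 0)
    (h : ∀ x Φ, (f x : H →L[ℂ] H) (W Φ) = S ((x : K →L[ℂ] K) (T Φ))) : IsNormalMap f := by
  intro D hne _ hdir a ha
  obtain ⟨U, hU, hUa⟩ := exists_ultrafilter_weakTendsto hne hdir ha
  obtain ⟨d₀⟩ := hne.to_subtype
  obtain ⟨c, hc⟩ := exists_weakTendsto U
    (fun d : ↥D => ((f d : ↥N.toStarSubalgebra) : H →L[ℂ] H)) _
    ((hU d₀).mono fun d hd => norm_le_of_between (hf hd) (hf (ha.1 d.2)))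
  have hcN : c ∈ N := hc.mem N fun d => (f d).2
  have hca : c = f a := by
    refine sub_eq_zero.1 (hW _ (sub_mem hcN (f a).2) fun Φ => ?_)
    rw [sub_apply, sub_eq_zero]
    refine ext_inner_right ℂ fun y => tendsto_nhds_unique (hc (W Φ) y) ?_
    simpa only [h, ← ContinuousLinearMap.adjoint_inner_right] using
      hUa (T Φ) (ContinuousLinearMap.adjoint S y)
  refine ⟨?_, fun u hu => ?_⟩
  · rintro _ ⟨d, hd, rfl⟩
    exact hf (ha.1 hd)
  · have : c ≤ (u : H →L[ℂ] H) := hc.ge_of_eventually_ge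
      (Eventually.of_forall fun d => hu ⟨d, d.2, rfl⟩)
    rw [hca] at this
    exact this

theorem sqrt_mem (M : VonNeumannAlgebra H) {x : H →L[ℂ] H} (hx : x ∈ M) : CFC.sqrt x ∈ M :=
  mem_of_commute M fun _ hT =>
    (Commute.cfcₙ_nnreal (b := _) (show Commute x _ from hT x hx) NNReal.sqrt).symm

theorem starAlgHom_nonneg {M : VonNeumannAlgebra K} {N : VonNeumannAlgebra H}
    (f : ↥M.toStarSubalgebra →⋆ₐ[ℂ] ↥N.toStarSubalgebra) {x : ↥M.toStarSubalgebra}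
    (hx : 0 ≤ x) : 0 ≤ f x := by
  have hx' : 0 ≤ (x : K →L[ℂ] K) := hx
  let y : ↥M.toStarSubalgebra := ⟨CFC.sqrt (x : K →L[ℂ] K), sqrt_mem M x.2⟩
  have hy : star y * y = x := Subtype.ext <| by
    change star (CFC.sqrt (x : K →L[ℂ] K)) * CFC.sqrt (x : K →L[ℂ] K) = x
    rw [(CFC.sqrt_nonneg (x : K →L[ℂ] K)).isSelfAdjoint.star_eq, CFC.sqrt_mul_sqrt_self _ hx']
  rw [← hy, map_mul, map_star]
  exact star_mul_self_nonneg (f y : H →L[ℂ] H)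

theorem starAlgHom_monotone {M : VonNeumannAlgebra K} {N : VonNeumannAlgebra H}
    (f : ↥M.toStarSubalgebra →⋆ₐ[ℂ] ↥N.toStarSubalgebra) : Monotone f := fun x y hxy => by
  have h : 0 ≤ y - x := by
    change (0 : K →L[ℂ] K) ≤ y - x
    exact sub_nonneg.2 hxy
  have h' := starAlgHom_nonneg f h
  rw [map_sub] at h'
  exact sub_nonneg.1 (show (0 : H →L[ℂ] H) ≤ f y - f x from h')

theorem isClosed_vonNeumannAlgebra (M : VonNeumannAlgebra H) :
    IsClosed (M.toStarSubalgebra : Set (H →L[ℂ] H)) := by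
  rw [VonNeumannAlgebra.coe_toStarSubalgebra, ← VonNeumannAlgebra.centralizer_centralizer]
  exact Set.isClosed_centralizer _

theorem starAlgHom_norm_le {M : VonNeumannAlgebra K} {N : VonNeumannAlgebra H}
    (f : ↥M.toStarSubalgebra →⋆ₐ[ℂ] ↥N.toStarSubalgebra) (x : ↥M.toStarSubalgebra) :
    ‖f x‖ ≤ ‖x‖ := by
  have := isClosed_vonNeumannAlgebra M
  have := isClosed_vonNeumannAlgebra N
  let : CStarAlgebra ↥M.toStarSubalgebra := StarSubalgebra.cstarAlgebra M.toStarSubalgebra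
  let : CStarAlgebra ↥N.toStarSubalgebra := StarSubalgebra.cstarAlgebra N.toStarSubalgebra
  exact NonUnitalStarAlgHom.norm_apply_le f x

end Normal

end GradedNets

end

noncomputable section

namespace GradedNets

theorem exists_doubleCone_subset_spacelikeComplement {s : ℕ} (hs : 1 ≤ s) (O : DoubleCone s) :
    ∃ O₁ : DoubleCone s,
      (O₁ : Set (Minkowski s)) ⊆ spacelikeComplement (O : Set (Minkowski s)) := by
  obtain ⟨O, a, b, hab, rfl⟩ := O
  let e : EuclideanSpace ℝ (Fin s) := EuclideanSpace.single ⟨0, hs⟩ 1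
  have he : ‖e‖ = 1 := by simp [e]
  have hab' : ‖b.2 - a.2‖ < b.1 - a.1 := hab
  have hL : 0 < b.1 - a.1 := (norm_nonneg _).trans_lt hab'
  let v := (3 * (b.1 - a.1)) • e
  have hv : ‖v‖ = 3 * (b.1 - a.1) := by
    rw [norm_smul, he, mul_one, Real.norm_of_nonneg (by positivity)]
  refine ⟨⟨_, a + (0, v), b + (0, v), ?_, rfl⟩, ?_⟩
  · rwa [add_sub_add_right_eq_sub]
  · rintro p ⟨hp₁, hp₂⟩ q ⟨hq₁, hq₂⟩
    have hp₁' : ‖p.2 - (a.2 + v)‖ < p.1 - (a.1 + 0) := hp₁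
    have hp₂' : ‖(b.2 + v) - p.2‖ < (b.1 + 0) - p.1 := hp₂
    have hq₁' : ‖q.2 - a.2‖ < q.1 - a.1 := hq₁
    have hq₂' : ‖b.2 - q.2‖ < b.1 - q.1 := hq₂
    have h₁ := norm_nonneg (p.2 - (a.2 + v))
    have h₂ := norm_nonneg ((b.2 + v) - p.2)
    have h₃ := norm_nonneg (q.2 - a.2)
    have h₄ := norm_nonneg (b.2 - q.2)
    have h₅ : ‖v‖ ≤ ‖p.2 - q.2‖ + ‖q.2 - a.2‖ + ‖p.2 - (a.2 + v)‖ := by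
      have : v = (p.2 - q.2) + (q.2 - a.2) - (p.2 - (a.2 + v)) := by abel
      calc ‖v‖ = ‖(p.2 - q.2) + (q.2 - a.2) - (p.2 - (a.2 + v))‖ := by rw [← this]
        _ ≤ _ := (norm_sub_le _ _).trans (add_le_add_left (norm_add_le _ _) _)
    have h₆ : |p.1 - q.1| < b.1 - a.1 := abs_lt.2 ⟨by linarith, by linarith⟩
    linarith

variable {s : ℕ} {K H : Type*}
  [NormedAddCommGroup K] [InnerProductSpace ℂ K] [CompleteSpace K]
  [NormedAddCommGroup H] [InnerProductSpace ℂ H] [CompleteSpace H]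

theorem GradedNet.k_mul_k_apply (F : GradedNet s H) (x : H) : F.k (F.k x) = x :=
  congrArg (fun A : H →L[ℂ] H => A x) F.k_mul_k

theorem GradedNet.even_part_mem (F : GradedNet s H) {O : DoubleCone s} {A : H →L[ℂ] H}
    (hA : A ∈ F.alg O) : (2⁻¹ : ℂ) • (A + F.k * A * F.k) ∈ F.even O := by
  have e : F.k * (F.k * A * F.k) * F.k = A := by
    rw [mul_assoc, mul_assoc, mul_assoc, F.k_mul_k, mul_one, ← mul_assoc, F.k_mul_k, one_mul]
  refine ⟨(F.alg O).toStarSubalgebra.smul_mem (add_mem hA (F.k_conj O A hA)) _, ?_⟩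
  rw [mul_smul_comm, smul_mul_assoc, mul_add, add_mul, e, add_comm]

theorem GradedNet.odd_part_mem (F : GradedNet s H) {O : DoubleCone s} {A : H →L[ℂ] H}
    (hA : A ∈ F.alg O) : (2⁻¹ : ℂ) • (A - F.k * A * F.k) ∈ F.odd O := by
  have e : F.k * (F.k * A * F.k) * F.k = A := by
    rw [mul_assoc, mul_assoc, mul_assoc, F.k_mul_k, mul_one, ← mul_assoc, F.k_mul_k, one_mul]
  refine ⟨(F.alg O).toStarSubalgebra.smul_mem (sub_mem hA (F.k_conj O A hA)) _, ?_⟩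
  rw [mul_smul_comm, smul_mul_assoc, mul_sub, sub_mul, e, ← smul_neg, neg_sub]

theorem GradedNet.even_mem_twisted (F : GradedNet s H) {O : DoubleCone s} {A : H →L[ℂ] H}
    (hA : A ∈ F.even O) : A ∈ F.twisted O :=
  ⟨A, hA, 0, ⟨zero_mem _, by simp⟩, by simp⟩

theorem GradedNet.odd_mem_twisted (F : GradedNet s H) {O : DoubleCone s} {C : H →L[ℂ] H}
    (hC : C ∈ F.odd O) : Complex.I • (F.k * C) ∈ F.twisted O :=
  ⟨0, ⟨zero_mem _, by simp⟩, C, hC, by simp⟩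

namespace NetInclusion

variable {B : GradedNet s K} {F : GradedNet s H} (i : NetInclusion B F)

/-- The adjoint of the inclusion of the Hilbert spaces. -/
abbrev Vadj : H →L[ℂ] K := ContinuousLinearMap.adjoint i.V.toContinuousLinearMap

theorem Vadj_V (Φ : K) : i.Vadj (i.V Φ) = Φ := by
  refine ext_inner_right ℂ fun y => ?_
  rw [ContinuousLinearMap.adjoint_inner_left]
  exact i.V.inner_map_map Φ y

theorem E_apply (x : H) : i.E x = i.V (i.Vadj x) := rfl

theorem Vadj_k (x : H) : i.Vadj (F.k x) = B.k (i.Vadj x) := by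
  have hF : ∀ x y : H, inner ℂ (F.k x) y = inner ℂ x (F.k y) := fun x y => by
    rw [← ContinuousLinearMap.adjoint_inner_right, ← ContinuousLinearMap.star_eq_adjoint, F.star_k]
  have hB : ∀ x y : K, inner ℂ (B.k x) y = inner ℂ x (B.k y) := fun x y => by
    rw [← ContinuousLinearMap.adjoint_inner_right, ← ContinuousLinearMap.star_eq_adjoint, B.star_k]
  refine ext_inner_right ℂ fun y => ?_
  rw [ContinuousLinearMap.adjoint_inner_left, hF, hB, ContinuousLinearMap.adjoint_inner_left]
  exact congrArg _ (i.V_k y).symm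

/-- Operators `X` and `X*` that extend `A` and `A*` intertwine with the adjoint of `V`. -/
theorem Vadj_apply {X : H →L[ℂ] H} {A : K →L[ℂ] K}
    (h : ∀ Φ, star X (i.V Φ) = i.V (star A Φ)) (x : H) : i.Vadj (X x) = A (i.Vadj x) := by
  refine ext_inner_right ℂ fun y => ?_
  rw [ContinuousLinearMap.adjoint_inner_left, ← ContinuousLinearMap.adjoint_inner_right,
    ← ContinuousLinearMap.adjoint_inner_right A, ContinuousLinearMap.adjoint_inner_left]
  exact congrArg _ (h y)

theorem star_apply {X : H →L[ℂ] H} {A : K →L[ℂ] K} (hX : X * i.E = i.E * X)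
    (h : ∀ Φ, X (i.V Φ) = i.V (A Φ)) (Φ : K) : star X (i.V Φ) = i.V (star A Φ) := by
  have hE : star i.E = i.E := by
    rw [ContinuousLinearMap.star_eq_adjoint, E, ContinuousLinearMap.adjoint_comp,
      ContinuousLinearMap.adjoint_adjoint]
  have h₁ : i.E * star X = star X * i.E := by
    simpa only [star_mul, hE] using congrArg star hX
  have h₂ : star X (i.V Φ) = i.V (i.Vadj (star X (i.V Φ))) := by
    have := congrArg (fun Y : H →L[ℂ] H => Y (i.V Φ)) h₁
    simpa only [mul_apply_eq_comp, E_apply, Vadj_V] using this.symm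
  rw [h₂]
  congr 1
  refine ext_inner_right ℂ fun y => ?_
  rw [ContinuousLinearMap.adjoint_inner_left, ContinuousLinearMap.star_eq_adjoint,
    ContinuousLinearMap.star_eq_adjoint, ContinuousLinearMap.adjoint_inner_left,
    ContinuousLinearMap.adjoint_inner_left]
  exact (congrArg _ (h y)).trans (i.V.inner_map_map _ _)

theorem commute_E {X : H →L[ℂ] H} {A : K →L[ℂ] K} (h : ∀ Φ, X (i.V Φ) = i.V (A Φ))
    (h' : ∀ Φ, star X (i.V Φ) = i.V (star A Φ)) : X * i.E = i.E * X := by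
  ext x
  simp only [mul_apply_eq_comp, E_apply, h, i.Vadj_apply h']

theorem ι_star (O : DoubleCone s) (A : B.Alg O) (Φ : K) :
    star (i.ι.map O A : H →L[ℂ] H) (i.V Φ) = i.V (star (A : K →L[ℂ] K) Φ) := by
  have := i.ι_apply_V O (star A) Φ
  rwa [map_star] at this

theorem ι_k_conj (O : DoubleCone s) (A : B.Alg O) :
    (i.ι.map O ⟨B.k * A * B.k, B.k_conj O A A.2⟩ : H →L[ℂ] H) = F.k * i.ι.map O A * F.k := by
  refine sub_eq_zero.1 (i.separating O _
    (sub_mem (i.ι.map O _).2 (F.k_conj O _ (i.ι.map O A).2)) fun Φ => ?_)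
  simp only [sub_apply, mul_apply_eq_comp, i.ι_apply_V, ← i.V_k,
    sub_self]

/-- The twisted algebras of the smaller net extend into those of the larger one. -/
theorem exists_twisted_extension {O : DoubleCone s} {T : K →L[ℂ] K} (hT : T ∈ B.twisted O) :
    ∃ T' ∈ F.twisted O, (∀ Φ, T' (i.V Φ) = i.V (T Φ)) ∧
      ∀ x, i.Vadj (T' x) = T (i.Vadj x) := by
  obtain ⟨A, hA, C, hC, rfl⟩ := hT
  let a : B.Alg O := ⟨A, hA.1⟩
  let c : B.Alg O := ⟨C, hC.1⟩
  refine ⟨i.ι.map O a + Complex.I • (F.k * i.ι.map O c), ⟨_, ⟨(i.ι.map O a).2, ?_⟩, _,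
    ⟨(i.ι.map O c).2, ?_⟩, rfl⟩, fun Φ => ?_, fun x => ?_⟩
  · rw [← i.ι_k_conj]
    exact congrArg (fun y => (i.ι.map O y : H →L[ℂ] H)) (Subtype.ext hA.2)
  · rw [← i.ι_k_conj]
    have : (⟨B.k * c * B.k, B.k_conj O c c.2⟩ : B.Alg O) = -c := Subtype.ext hC.2
    rw [this, map_neg]
    rfl
  · simp [i.ι_apply_V, ← i.V_k, a, c]
  · simp only [add_apply, smul_apply,
      mul_apply_eq_comp, map_add, map_smul, i.Vadj_k, i.Vadj_apply (i.ι_star O _)]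
    rfl

theorem compress_mem_dual {O : DoubleCone s} {X : H →L[ℂ] H} (hX : X ∈ F.dual.alg O) :
    i.Vadj ∘L X ∘L i.V.toContinuousLinearMap ∈ B.dual.alg O := by
  rw [GradedNet.mem_dual_alg_iff] at hX ⊢
  intro O₁ h₁ T hT
  obtain ⟨T', hT', hV, hVadj⟩ := i.exists_twisted_extension hT
  have h := hX O₁ h₁ T' hT'
  ext Φ
  change T (i.Vadj (X (i.V Φ))) = i.Vadj (X (i.V (T Φ)))
  rw [← hVadj, ← hV]
  exact congrArg (fun Y : H →L[ℂ] H => i.Vadj (Y (i.V Φ))) h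

theorem restrict_dual_subset (O : DoubleCone s) :
    i.restrict F.dual O ⊆ (B.dual.alg O : Set (K →L[ℂ] K)) := by
  rintro A ⟨X, hX, -, h⟩
  have e : A = i.Vadj ∘L X ∘L i.V.toContinuousLinearMap := by
    ext Φ
    exact ((congrArg i.Vadj (h Φ)).trans (i.Vadj_V _)).symm
  rw [e]
  exact i.compress_mem_dual hX

theorem dual_separating (hs : 1 ≤ s) (O : DoubleCone s) {X : H →L[ℂ] H}
    (hX : X ∈ F.dual.alg O) (h : ∀ Φ, X (i.V Φ) = 0) : X = 0 := by
  obtain ⟨O₁, h₁⟩ := exists_doubleCone_subset_spacelikeComplement hs O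
  rw [GradedNet.mem_dual_alg_iff] at hX
  have hT : ∀ T ∈ F.twisted O₁, ∀ Φ, X (T (i.V Φ)) = 0 := fun T hT Φ => by
    have := congrArg (fun Y : H →L[ℂ] H => Y (i.V Φ)) (hX O₁ h₁ T hT)
    exact this.symm.trans ((congrArg T (h Φ)).trans (map_zero T))
  have hodd : ∀ C ∈ F.odd O₁, ∀ Φ, X (C (i.V Φ)) = 0 := fun C hC Φ => by
    have e : C (i.V Φ) = Complex.I • (Complex.I • (F.k * C)) (i.V (B.k Φ)) := by
      have h₂ : C (F.k (i.V Φ)) = -F.k (C (i.V Φ)) :=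
        congrArg (fun Y : H →L[ℂ] H => Y (i.V Φ)) (F.odd_anticomm hC)
      rw [i.V_k, smul_apply, mul_apply_eq_comp, h₂, map_neg,
        F.k_mul_k_apply, smul_smul, Complex.I_mul_I, neg_one_smul, neg_neg]
    rw [e, map_smul, hT _ (F.odd_mem_twisted hC), smul_zero]
  have hle : (Submodule.span ℂ {x : H | ∃ A ∈ F.alg O₁, ∃ Φ : K, x = A (i.V Φ)}) ≤
      LinearMap.ker (X : H →ₗ[ℂ] H) := by
    rw [Submodule.span_le]
    rintro _ ⟨A, hA, Φ, rfl⟩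
    have e : A = (2⁻¹ : ℂ) • (A + F.k * A * F.k) + (2⁻¹ : ℂ) • (A - F.k * A * F.k) := by
      module
    change X (A (i.V Φ)) = 0
    rw [e, add_apply, map_add, hT _ (F.even_mem_twisted (F.even_part_mem hA)),
      hodd _ (F.odd_part_mem hA), add_zero]
  have htop := (Submodule.topologicalClosure_minimal _ hle X.isClosed_ker)
  rw [i.cyclic O₁] at htop
  ext x
  exact htop (Submodule.mem_top (x := x))

theorem dual_eq (hs : 1 ≤ s) {O : DoubleCone s} {X Y : H →L[ℂ] H} (hX : X ∈ F.dual.alg O)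
    (hY : Y ∈ F.dual.alg O) (h : ∀ Φ, X (i.V Φ) = Y (i.V Φ)) : X = Y :=
  sub_eq_zero.1 (i.dual_separating hs O (sub_mem hX hY) fun Φ => by
    rw [sub_apply, h, sub_self])

/-- The morphism of dual nets that extends operators, if extensions exist. -/
theorem exists_extension_morphism (hs : 1 ≤ s)
    (hb : ∀ O, (B.dual.alg O : Set (K →L[ℂ] K)) ⊆ i.restrict F.dual O) :
    ∃ ν : NetMorphism B.dual F.dual, ∀ O (A : B.dual.Alg O) (Φ : K),
      (ν.map O A : H →L[ℂ] H) (i.V Φ) = i.V ((A : K →L[ℂ] K) Φ) := by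
  have hex : ∀ O (A : B.dual.Alg O), ∃ X : F.dual.Alg O,
      (X : H →L[ℂ] H) * i.E = i.E * X ∧
        ∀ Φ : K, (X : H →L[ℂ] H) (i.V Φ) = i.V ((A : K →L[ℂ] K) Φ) := fun O A => by
    obtain ⟨X, hX, h⟩ := hb O A.2
    exact ⟨⟨X, hX⟩, h⟩
  choose f hfE hfV using hex
  have huniq : ∀ O (A : B.dual.Alg O) (X : F.dual.Alg O),
      (∀ Φ, (X : H →L[ℂ] H) (i.V Φ) = i.V ((A : K →L[ℂ] K) Φ)) → f O A = X :=
    fun O A X h => Subtype.ext (i.dual_eq hs (f O A).2 X.2 fun Φ => by rw [hfV, h])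
  refine ⟨⟨fun O =>
    { toFun := f O
      map_one' := huniq _ _ _ fun Φ => rfl
      map_mul' := fun A A' => huniq _ _ _ fun Φ => by
        change (f O A : H →L[ℂ] H) ((f O A' : H →L[ℂ] H) (i.V Φ)) = _
        rw [hfV, hfV]
        rfl
      map_zero' := huniq _ _ _ fun Φ => (map_zero i.V).symm
      map_add' := fun A A' => huniq _ _ _ fun Φ => by
        change (f O A : H →L[ℂ] H) (i.V Φ) + (f O A' : H →L[ℂ] H) (i.V Φ) = _
        rw [hfV, hfV, ← map_add]
        rfl
      commutes' := fun r => huniq _ _ _ fun Φ => (map_smul i.V r Φ).symm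
      map_star' := fun A => huniq _ _ _ fun Φ => i.star_apply (hfE O A) (hfV O A) Φ },
    fun O₁ O₂ h A => ?_⟩, hfV⟩
  exact congrArg Subtype.val
    (huniq O₂ ⟨A, B.dual.mono h A.2⟩ ⟨f O₁ A, F.dual.mono h (f O₁ A).2⟩ (hfV O₁ A))

/-- A morphism of dual nets that extends operators. -/
def IsExtension (ν : NetMorphism B.dual F.dual) : Prop :=
  ∀ O (A : B.dual.Alg O) (Φ : K),
    (ν.map O A : H →L[ℂ] H) (i.V Φ) = i.V ((A : K →L[ℂ] K) Φ)

namespace IsExtension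

variable {i} {ν : NetMorphism B.dual F.dual} (hν : i.IsExtension ν)
include hν

theorem star_apply (O : DoubleCone s) (A : B.dual.Alg O) (Φ : K) :
    star (ν.map O A : H →L[ℂ] H) (i.V Φ) = i.V (star (A : K →L[ℂ] K) Φ) := by
  have := hν O (star A) Φ
  rwa [map_star] at this

theorem Vadj_apply (O : DoubleCone s) (A : B.dual.Alg O) (x : H) :
    i.Vadj ((ν.map O A : H →L[ℂ] H) x) = (A : K →L[ℂ] K) (i.Vadj x) :=
  i.Vadj_apply (hν.star_apply O A) x

theorem subset_restrict (O : DoubleCone s) :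
    (B.dual.alg O : Set (K →L[ℂ] K)) ⊆ i.restrict F.dual O := fun A hA =>
  ⟨ν.map O ⟨A, hA⟩, (ν.map O ⟨A, hA⟩).2, i.commute_E (hν O ⟨A, hA⟩) (hν.star_apply O ⟨A, hA⟩),
    hν O ⟨A, hA⟩⟩

theorem injective (O : DoubleCone s) : Function.Injective (ν.map O) := fun A A' h => by
  refine Subtype.ext (ContinuousLinearMap.ext fun Φ => i.V.injective ?_)
  rw [← hν O A, ← hν O A', h]

theorem normal (hs : 1 ≤ s) (O : DoubleCone s) : IsNormalMap (ν.map O) :=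
  isNormalMap_of_intertwines _ (starAlgHom_monotone (ν.map O)) i.V i.V.toContinuousLinearMap id
    (fun _ hA h => i.dual_separating hs O hA h) (hν O)

theorem k_conj (hs : 1 ≤ s) (O : DoubleCone s) (A : B.dual.Alg O) :
    (ν.map O ⟨B.k * A * B.k, B.dual.k_conj O A A.2⟩ : H →L[ℂ] H) = F.k * ν.map O A * F.k := by
  refine i.dual_eq hs (ν.map O _).2 (F.dual.k_conj O _ (ν.map O A).2) fun Φ => ?_
  rw [hν]
  simp only [mul_apply_eq_comp, ← i.V_k, hν O A]

end IsExtension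

/-- Compression of the dual net of the larger net to the smaller Hilbert space. -/
def compress (O : DoubleCone s) : F.dual.Alg O →ₗ[ℂ] B.dual.Alg O where
  toFun X := ⟨i.Vadj ∘L (X : H →L[ℂ] H) ∘L i.V.toContinuousLinearMap, i.compress_mem_dual X.2⟩
  map_add' _ _ := Subtype.ext <| ContinuousLinearMap.ext fun _ => map_add i.Vadj _ _
  map_smul' r _ := Subtype.ext <| ContinuousLinearMap.ext fun _ => map_smul i.Vadj r _

theorem compress_apply (O : DoubleCone s) (X : F.dual.Alg O) (Φ : K) :
    (i.compress O X : K →L[ℂ] K) Φ = i.Vadj ((X : H →L[ℂ] H) (i.V Φ)) := rfl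

theorem norm_compress_le (O : DoubleCone s) (X : F.dual.Alg O) : ‖i.compress O X‖ ≤ ‖X‖ := by
  refine ContinuousLinearMap.opNorm_le_bound _ (norm_nonneg _) fun Φ => ?_
  change ‖i.Vadj ((X : H →L[ℂ] H) (i.V Φ))‖ ≤ _
  calc ‖i.Vadj ((X : H →L[ℂ] H) (i.V Φ))‖ = ‖i.E ((X : H →L[ℂ] H) (i.V Φ))‖ :=
        (i.V.norm_map _).symm
    _ ≤ 1 * ‖(X : H →L[ℂ] H) (i.V Φ)‖ := by
        rw [E_apply, i.V.norm_map]
        refine ContinuousLinearMap.le_of_opNorm_le _ ?_ _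
        rw [LinearIsometryEquiv.norm_map]
        exact i.V.norm_toContinuousLinearMap_le
    _ ≤ ‖X‖ * ‖Φ‖ := by
        rw [one_mul, ← i.V.norm_map Φ]
        exact (X : H →L[ℂ] H).le_opNorm _

theorem compress_nonneg (O : DoubleCone s) {X : F.dual.Alg O} (hX : 0 ≤ X) :
    0 ≤ i.compress O X := by
  have hX' : 0 ≤ (X : H →L[ℂ] H) := hX
  refine (operator_nonneg_iff (i.compress O X : K →L[ℂ] K)).2 fun Φ => ?_
  rw [compress_apply, ContinuousLinearMap.adjoint_inner_left]
  exact (operator_nonneg_iff _).1 hX' (i.V Φ)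

namespace IsExtension

variable {i} {ν : NetMorphism B.dual F.dual} (hν : i.IsExtension ν)
include hν

theorem compress_map (O : DoubleCone s) (A : B.dual.Alg O) : i.compress O (ν.map O A) = A :=
  Subtype.ext <| ContinuousLinearMap.ext fun Φ => by
    rw [compress_apply, hν, i.Vadj_V]

theorem map_compress_apply (O : DoubleCone s) (X : F.dual.Alg O) (Φ : K) :
    (ν.map O (i.compress O X) : H →L[ℂ] H) (i.V Φ) = i.E ((X : H →L[ℂ] H) (i.V Φ)) :=
  hν O _ Φ

theorem isNetCondExp : IsNetCondExp F.dual (fun O => (ν.map O).range)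
    (fun O => (ν.map O).toAlgHom.toLinearMap ∘ₗ i.compress O) where
  condExp O :=
    { range_eq := by
        ext X
        constructor
        · rintro ⟨Y, rfl⟩
          exact ⟨i.compress O Y, rfl⟩
        · rintro ⟨A, rfl⟩
          exact ⟨ν.map O A, congrArg (ν.map O) (hν.compress_map O A)⟩
      map_of_mem := by
        rintro _ ⟨A, rfl⟩
        exact congrArg (ν.map O) (hν.compress_map O A)
      nonneg := fun X hX => starAlgHom_nonneg (ν.map O) (i.compress_nonneg O hX)
      norm_le := fun X => (starAlgHom_norm_le (ν.map O) _).trans (i.norm_compress_le O X)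
      bimodule := by
        rintro _ ⟨A, rfl⟩ _ ⟨A', rfl⟩ X
        have e : i.compress O (ν.map O A * X * ν.map O A') = A * i.compress O X * A' := by
          refine Subtype.ext <| ContinuousLinearMap.ext fun Φ => ?_
          rw [compress_apply]
          change i.Vadj ((ν.map O A : H →L[ℂ] H) ((X : H →L[ℂ] H)
            ((ν.map O A' : H →L[ℂ] H) (i.V Φ)))) = _
          rw [hν.Vadj_apply, hν]
          rfl
        change ν.map O (i.compress O (ν.map O A * X * ν.map O A')) = _
        rw [e, map_mul, map_mul]
        rfl }
  compat O₁ O₂ h X := ν.compat h (i.compress O₁ X)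

theorem condExp_normal (hs : 1 ≤ s) (O : DoubleCone s) :
    IsNormalMap ((ν.map O).toAlgHom.toLinearMap ∘ₗ i.compress O) := by
  refine isNormalMap_of_intertwines _ (fun X Y hXY => starAlgHom_monotone (ν.map O) ?_) i.V i.E i.V
    (fun _ hA h => i.dual_separating hs O hA h) (hν.map_compress_apply O)
  have h : 0 ≤ Y - X := by
    change (0 : H →L[ℂ] H) ≤ Y - X
    exact sub_nonneg.2 hXY
  have h' := i.compress_nonneg O h
  rw [map_sub] at h'
  exact sub_nonneg.1 (show (0 : K →L[ℂ] K) ≤ i.compress O Y - i.compress O X from h')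

end IsExtension

end NetInclusion

end GradedNets

end

theorem lemma3p4 {s : ℕ} (hs : 1 ≤ s) {K H : Type*}
    [NormedAddCommGroup K] [InnerProductSpace ℂ K] [CompleteSpace K]
    [NormedAddCommGroup H] [InnerProductSpace ℂ H] [CompleteSpace H]
    (B : GradedNets.GradedNet s K) (F : GradedNets.GradedNet s H)
    (i : GradedNets.NetInclusion B F) :
    ((∃ ν : GradedNets.NetMorphism B.dual F.dual,
        ∀ O (A : B.dual.Alg O) (Φ : K),
          (ν.map O A : H →L[ℂ] H) (i.V Φ) = i.V ((A : K →L[ℂ] K) Φ)) ↔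
      ∀ O, (B.dual.alg O : Set (K →L[ℂ] K)) = i.restrict F.dual O) ∧
    ∀ ν : GradedNets.NetMorphism B.dual F.dual,
      (∀ O (A : B.dual.Alg O) (Φ : K),
        (ν.map O A : H →L[ℂ] H) (i.V Φ) = i.V ((A : K →L[ℂ] K) Φ)) →
      (∀ ν' : GradedNets.NetMorphism B.dual F.dual,
        (∀ O (A : B.dual.Alg O) (Φ : K),
          (ν'.map O A : H →L[ℂ] H) (i.V Φ) = i.V ((A : K →L[ℂ] K) Φ)) → ν' = ν) ∧
      (∀ O, Function.Injective (ν.map O)) ∧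
      (∀ O, GradedNets.IsNormalMap (ν.map O)) ∧
      (∀ O (A : B.dual.Alg O),
        (ν.map O ⟨B.k * A * B.k, B.dual.k_conj O A A.2⟩ : H →L[ℂ] H) =
          F.k * ν.map O A * F.k) ∧
      ∃! m : ∀ O, F.dual.Alg O →ₗ[ℂ] F.dual.Alg O,
        GradedNets.IsNetCondExp F.dual (fun O => (ν.map O).range) m ∧
        (∀ O, GradedNets.IsNormalMap (m O)) ∧
        ∀ O (A : F.dual.Alg O),
          (m O A : H →L[ℂ] H) * i.E = i.E * (A : H →L[ℂ] H) * i.E := by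
  refine ⟨⟨fun ⟨ν, hν⟩ O => Set.Subset.antisymm
      (GradedNets.NetInclusion.IsExtension.subset_restrict hν O) (i.restrict_dual_subset O),
    fun hb => i.exists_extension_morphism hs fun O => (hb O).subset⟩, fun ν hν => ?_⟩
  have hν' : i.IsExtension ν := hν
  refine ⟨fun ν' h => ?_, hν'.injective, hν'.normal hs, hν'.k_conj hs, _,
    ⟨hν'.isNetCondExp, hν'.condExp_normal hs, fun O A => ?_⟩, fun m hm => ?_⟩
  · refine GradedNets.NetMorphism.ext (funext fun O => StarAlgHom.ext fun A => Subtype.ext ?_)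
    exact i.dual_eq hs (ν'.map O A).2 (ν.map O A).2 fun Φ => by rw [h, hν]
  · ext x
    exact hν'.map_compress_apply O A (i.Vadj x)
  · refine funext fun O => LinearMap.ext fun A => Subtype.ext ?_
    refine i.dual_eq hs (m O A).2 (ν.map O (i.compress O A)).2 fun Φ => ?_
    have h := congrArg (fun Y : H →L[ℂ] H => Y (i.V Φ)) (hm.2.2 O A)
    simp only [mul_apply_eq_comp, i.E_apply, i.Vadj_V] at h
    exact h.trans (hν'.map_compress_apply O A Φ).symm
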